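/- Let $G$ be a nonempty Hausdorff ample groupoid, that is, a nonempty Hausdorff topological groupoid (a groupoid, viewed as its set of arrows with a partially defined product, with a topology for which composition and inversion are continuous) whose topology has a basis of compact open bisections. Write $r(\alpha)=\alpha\alpha^{-1}$ and $s(\alpha)=\alpha^{-1}\alpha$, and let $G^{(0)}=r(G)=s(G)$ be the unit space; an open bisection is an open set $B\subseteq G$ such that $r|_B$ and $s|_B$ are homeomorphisms onto open subsets of $G^{(0)}$. Let $R$ be a commutative ring with identity, and let $A_R(G)$ be the Steinberg algebra: the $R$-algebra of all locally constant functions $f:G\to R$ with compact support, with pointwise addition and scalar multiplication and the convolution product $$(f*g)(\alpha)=\sum_{r(\beta)=r(\alpha)} f(\beta)\,g(\beta^{-1}\alpha).$$ Then $A_R(G)$ is simple (that is, $A_R(G)\neq 0$ and its only two-sided ideals are $0$ and $A_R(G)$) if and only if all of the following hold: (i) $G$ is effective: the interior of $\{\gamma\in G: s(\gamma)=r(\gamma)\}\setminus G^{(0)}$ is empty; (ii) $G$ is minimal: the only open subsets $U\subseteq G^{(0)}$ with $r(s^{-1}(U))=U$ are $\emptyset$ and $G^{(0)}$; (iii) $R$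 is a field. -/

import Mathlib

open Topology

namespace Steinberg

/-- A groupoid, as a set `G` with a partially defined product and an involution `a ↦ a⁻¹`.
`Comp a b` says that `(a, b)` lies in the set of composable pairs. The product is represented
by a total function, whose values on non-composable pairs carry no meaning and are never used. -/
class Groupoid (G : Type*) extends Mul G, Inv G where
  /-- composability: `(a, b) ∈ G⁽²⁾` -/
  Comp : G → G → Prop
  inv_inv' : ∀ a : G, (a⁻¹)⁻¹ = a
  comp_mul_left : ∀ a b c : G, Comp a b → Comp b c → Comp (a * b) c
  comp_mul_right : ∀ a b c : G, Comp a b → Comp b c → Comp a (b * c)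
  mul_assoc' : ∀ a b c : G, Comp a b → Comp b c → (a * b) * c = a * (b * c)
  comp_inv_self : ∀ a : G, Comp a⁻¹ a
  inv_mul_cancel' : ∀ a b : G, Comp a b → a⁻¹ * (a * b) = b
  mul_inv_cancel' : ∀ a b : G, Comp a b → (a * b) * b⁻¹ = a

open Groupoid

section Algebraic

variable {G : Type*} [Groupoid G]

/-- The range `r(a) = a a⁻¹`. -/
def rng (a : G) : G := a * a⁻¹

/-- The source `s(a) = a⁻¹ a`. -/
def src (a : G) : G := a⁻¹ * a

variable (G) in
/-- The unit space `G⁽⁰⁾`, the common image of the range and the source map. -/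
def unitSpace : Set G := Set.range (src : G → G)

theorem comp_self_inv (a : G) : Comp a a⁻¹ := by
  have h := comp_inv_self a⁻¹
  rwa [inv_inv'] at h

theorem src_inv (a : G) : src a⁻¹ = rng a := by
  unfold src rng
  rw [inv_inv']

theorem rng_inv (a : G) : rng a⁻¹ = src a := by
  unfold src rng
  rw [inv_inv']

theorem rng_mem_unitSpace (a : G) : rng a ∈ unitSpace G := ⟨a⁻¹, src_inv a⟩

theorem src_mem_unitSpace (a : G) : src a ∈ unitSpace G := ⟨a, rfl⟩

theorem unitSpace_eq_range_rng : unitSpace G = Set.range (rng : G → G) := by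
  ext x
  constructor
  · rintro ⟨a, rfl⟩
    exact ⟨a⁻¹, rng_inv a⟩
  · rintro ⟨a, rfl⟩
    exact rng_mem_unitSpace a

theorem comp_iff (a b : G) : Comp a b ↔ src a = rng b := by
  constructor
  · intro h
    have h1 : src a * b = b := by
      unfold src
      rw [mul_assoc' _ _ _ (comp_inv_self a) h, inv_mul_cancel' a b h]
    have h2 := mul_inv_cancel' (src a) b (comp_mul_left _ _ _ (comp_inv_self a) h)
    rw [h1] at h2
    exact h2.symm
  · intro h
    have h1 : Comp a (src a) := comp_mul_right _ _ _ (comp_self_inv a) (comp_inv_self a)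
    have h2 : a * src a = a := by
      unfold src
      rw [← mul_assoc' _ _ _ (comp_self_inv a) (comp_inv_self a)]
      have := mul_inv_cancel' a a⁻¹ (comp_self_inv a)
      rwa [inv_inv'] at this
    have h3 : Comp (src a) b := by
      rw [h]
      exact comp_mul_left _ _ _ (comp_self_inv b) (comp_inv_self b)
    have h4 := comp_mul_left _ _ _ h1 h3
    rwa [h2] at h4

theorem rng_mul {a b : G} (h : Comp a b) : rng (a * b) = rng a := by
  have h1 : Comp a⁻¹ (a * b) := comp_mul_right _ _ _ (comp_inv_self a) h
  have h2 := (comp_iff _ _).1 h1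
  rw [← h2, src_inv]

theorem src_mul {a b : G} (h : Comp a b) : src (a * b) = src b := by
  have h1 : Comp (a * b) b⁻¹ := comp_mul_left _ _ _ h (comp_self_inv b)
  have h2 := (comp_iff _ _).1 h1
  rw [h2, rng_inv]

/-- The range map as a map `r : G → G⁽⁰⁾`. -/
def rangeMap (a : G) : unitSpace G := ⟨rng a, rng_mem_unitSpace a⟩

/-- The source map as a map `s : G → G⁽⁰⁾`. -/
def sourceMap (a : G) : unitSpace G := ⟨src a, src_mem_unitSpace a⟩

variable (G) in
/-- The isotropy subgroupoid `Iso(G)`. -/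
def isotropy : Set G := {a | src a = rng a}

/-- A set `U` of units is invariant if `r(s⁻¹(U)) = U`. -/
def IsInvariant (U : Set (unitSpace G)) : Prop := rangeMap '' (sourceMap ⁻¹' U) = U

end Algebraic

/-- A topological groupoid: composition (on the space of composable pairs, a subspace of
`G × G`) and inversion are continuous. -/
class IsTopologicalGroupoid (G : Type*) [TopologicalSpace G] [Groupoid G] : Prop where
  continuousOn_mul : ContinuousOn (fun p : G × G => p.1 * p.2) {p | Comp p.1 p.2}
  continuous_inv' : Continuous (fun a : G => a⁻¹)

section Topological

variable {G : Type*} [TopologicalSpace G] [Groupoid G]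

/-- An open bisection: an open set `B ⊆ G` such that `r` and `s` restrict to
homeomorphisms of `B` onto open subsets of the unit space. -/
structure IsOpenBisection (B : Set G) : Prop where
  isOpen : IsOpen B
  range_homeo : IsOpenEmbedding (B.domRestrict (rangeMap : G → unitSpace G))
  source_homeo : IsOpenEmbedding (B.domRestrict (sourceMap : G → unitSpace G))

variable (G) in
/-- `G` is ample if the compact open bisections form a basis of its topology. -/
class IsAmple : Prop where
  isTopologicalBasis : TopologicalSpace.IsTopologicalBasis
    {B : Set G | IsCompact B ∧ IsOpenBisection B}

variable (G) in
/-- `G` is effective if the interior of `Iso(G) \ G⁽⁰⁾` is empty. -/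
def IsEffective : Prop := interior (isotropy G \ unitSpace G) = ∅

variable (G) in
/-- `G` is minimal if the only open invariant subsets of `G⁽⁰⁾` are `∅` and `G⁽⁰⁾`. -/
def IsMinimal : Prop :=
  ∀ U : Set (unitSpace G), IsOpen U → IsInvariant U → U = ∅ ∨ U = Set.univ

end Topological

section Convolution

variable {G : Type*} [Groupoid G] {R : Type*} [CommRing R]

/-- Convolution: `(f * g)(α) = ∑_{r(β) = r(α)} f(β) g(β⁻¹ α)`. For locally constant functions
with compact support on an ample Hausdorff groupoid the sum has finitely many nonzero terms;
see `finite_fibre`. -/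
noncomputable def conv (f g : G → R) (α : G) : R :=
  ∑ᶠ (β : G) (_ : rng β = rng α), f β * g (β⁻¹ * α)

theorem conv_eq_of_mem {B : Set G} (hB : Set.InjOn rng B) {f : G → R}
    (hf : Function.support f ⊆ B) (g : G → R) {α β : G} (hβ : β ∈ B) (h : rng β = rng α) :
    conv f g α = f β * g (β⁻¹ * α) := by
  unfold conv
  rw [finsum_eq_single _ β]
  · simp [h]
  · intro γ hγ
    by_cases h1 : rng γ = rng α
    · have : f γ = 0 := by
        by_contra h2
        exact hγ (hB (hf h2) hβ (h1.trans h.symm))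
      simp [this]
    · simp [h1]

theorem conv_eq_zero {f : G → R} (g : G → R) {α : G}
    (h : ∀ β, rng β = rng α → f β = 0) : conv f g α = 0 := by
  unfold conv
  rw [← finsum_zero (α := G)]
  congr 1
  ext β
  by_cases h1 : rng β = rng α
  · simp [h β h1]
  · simp [h1]

theorem zero_conv (g : G → R) : conv 0 g = 0 := by
  ext α
  exact conv_eq_zero g (fun _ _ => rfl)

theorem conv_zero (f : G → R) : conv f 0 = 0 := by
  ext α
  simp [conv]

/-- The condition under which the sums defining a convolution with `f` are finite. -/
def FiniteFibres (f : G → R) : Prop := ∀ α : G, {β | rng β = rng α ∧ f β ≠ 0}.Finite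

theorem FiniteFibres.support_finite {f : G → R} (hf : FiniteFibres f) (α : G) (k : G → R) :
    ({β : G | rng β = rng α} ∩ Function.support fun β => f β * k β).Finite := by
  refine (hf α).subset ?_
  rintro β ⟨h1, h2⟩
  exact ⟨h1, fun h => h2 (by simp [h])⟩

theorem add_conv {f f' : G → R} (hf : FiniteFibres f) (hf' : FiniteFibres f') (g : G → R) :
    conv (f + f') g = conv f g + conv f' g := by
  ext α
  have := finsum_mem_add_distrib' (hf.support_finite α fun β => g (β⁻¹ * α))
    (hf'.support_finite α fun β => g (β⁻¹ * α))
  simp only [Set.mem_ofPred_eq] at this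
  simp only [conv, Pi.add_apply, add_mul]
  exact this

theorem conv_add {f : G → R} (hf : FiniteFibres f) (g g' : G → R) :
    conv f (g + g') = conv f g + conv f g' := by
  ext α
  have := finsum_mem_add_distrib' (hf.support_finite α fun β => g (β⁻¹ * α))
    (hf.support_finite α fun β => g' (β⁻¹ * α))
  simp only [Set.mem_ofPred_eq] at this
  simp only [conv, Pi.add_apply, mul_add]
  exact this

theorem mul_conv_apply {f : G → R} (hf : FiniteFibres f) (c : R) (k : G → R) (α : G) :
    c * ∑ᶠ (β : G) (_ : rng β = rng α), f β * k β =
      ∑ᶠ (β : G) (_ : rng β = rng α), c * (f β * k β) :=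
  ((AddMonoidHom.mulLeft c).map_finsum_mem' (hf.support_finite α k))

theorem smul_conv {f : G → R} (hf : FiniteFibres f) (c : R) (g : G → R) :
    conv (c • f) g = c • conv f g := by
  ext α
  simp only [conv, Pi.smul_apply, smul_eq_mul]
  rw [mul_conv_apply hf c fun β => g (β⁻¹ * α)]
  simp only [mul_assoc]

theorem conv_smul {f : G → R} (hf : FiniteFibres f) (c : R) (g : G → R) :
    conv f (c • g) = c • conv f g := by
  ext α
  simp only [conv, Pi.smul_apply, smul_eq_mul]
  rw [mul_conv_apply hf c fun β => g (β⁻¹ * α)]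
  simp only [mul_left_comm]

theorem conv_assoc_of_injOn {B : Set G} (hB : Set.InjOn rng B) {f : G → R}
    (hf : Function.support f ⊆ B) {g : G → R} (hg : FiniteFibres g) (h : G → R) :
    conv (conv f g) h = conv f (conv g h) := by
  ext α
  by_cases hα : ∃ β ∈ B, rng β = rng α
  · obtain ⟨β, hβ, hr⟩ := hα
    have hcα : Comp β⁻¹ α := by rw [comp_iff, src_inv, hr]
    rw [conv_eq_of_mem hB hf _ hβ hr]
    have e1 : conv (conv f g) h α =
        ∑ᶠ γ ∈ {γ : G | rng γ = rng α}, f β * (g (β⁻¹ * γ) * h (γ⁻¹ * α)) := by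
      unfold conv
      refine finsum_mem_congr rfl fun γ hγ => ?_
      have := conv_eq_of_mem hB hf g hβ (hr.trans (Eq.symm hγ))
      unfold conv at this
      rw [this, mul_assoc]
    have e2 : f β * conv g h (β⁻¹ * α) =
        ∑ᶠ δ ∈ {δ : G | rng δ = rng (β⁻¹ * α)},
          f β * (g δ * h (δ⁻¹ * (β⁻¹ * α))) :=
      mul_conv_apply hg (f β) (fun δ => h (δ⁻¹ * (β⁻¹ * α))) (β⁻¹ * α)
    rw [e1, e2]
    refine finsum_mem_eq_of_bijOn (fun γ => β⁻¹ * γ) ⟨?_, ?_, ?_⟩ ?_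
    · intro γ hγ
      have hc : Comp β⁻¹ γ := by rw [comp_iff, src_inv, hr]; exact Eq.symm hγ
      change rng (β⁻¹ * γ) = rng (β⁻¹ * α)
      rw [rng_mul hc, rng_mul hcα]
    · intro γ hγ γ' hγ' he
      have hc : Comp β⁻¹ γ := by rw [comp_iff, src_inv, hr]; exact Eq.symm hγ
      have hc' : Comp β⁻¹ γ' := by rw [comp_iff, src_inv, hr]; exact Eq.symm hγ'
      rw [← inv_mul_cancel' _ _ hc, ← inv_mul_cancel' _ _ hc']
      exact congrArg (fun x => β⁻¹⁻¹ * x) he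
    · intro δ hδ
      have hδ' : rng δ = src β := by
        have : rng δ = rng (β⁻¹ * α) := hδ
        rw [this, rng_mul hcα, rng_inv]
      have hc : Comp β δ := by rw [comp_iff, hδ']
      exact ⟨β * δ, (rng_mul hc).trans hr, inv_mul_cancel' _ _ hc⟩
    · intro γ hγ
      have hc : Comp β⁻¹ γ := by rw [comp_iff, src_inv, hr]; exact Eq.symm hγ
      have key : (β⁻¹ * γ)⁻¹ * (β⁻¹ * α) = γ⁻¹ * α := by
        have h1 : Comp γ⁻¹ α := by rw [comp_iff, src_inv]; exact hγ
        have h2 : Comp γ (γ⁻¹ * α) := comp_mul_right _ _ _ (comp_self_inv γ) h1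
        have h3 : γ * (γ⁻¹ * α) = α := by
          have := inv_mul_cancel' γ⁻¹ α h1
          rwa [inv_inv'] at this
        have h4 : β⁻¹ * α = (β⁻¹ * γ) * (γ⁻¹ * α) := by
          rw [mul_assoc' _ _ _ hc h2, h3]
        rw [h4, inv_mul_cancel' _ _ (comp_mul_left _ _ _ hc h2)]
      change f β * (g (β⁻¹ * γ) * h (γ⁻¹ * α)) =
        f β * (g (β⁻¹ * γ) * h ((β⁻¹ * γ)⁻¹ * (β⁻¹ * α)))
      rw [key]
  · have h0 : ∀ γ : G, rng γ = rng α → ∀ β, rng β = rng γ → f β = 0 := by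
      intro γ hγ β hβ
      by_contra hne
      exact hα ⟨β, hf hne, hβ.trans hγ⟩
    rw [conv_eq_zero _ (h0 α rfl), conv_eq_zero]
    intro γ hγ
    exact conv_eq_zero _ (h0 γ hγ)

end Convolution

section SteinbergAlgebra

variable {R : Type*} [CommRing R] {G : Type*} [TopologicalSpace G]

variable (R G) in
/-- The `R`-module of locally constant functions `G → R` with compact support. -/
def steinbergSubmodule : Submodule R (G → R) where
  carrier := {f | IsLocallyConstant f ∧ HasCompactSupport f}
  zero_mem' := ⟨IsLocallyConstant.const 0, HasCompactSupport.zero⟩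
  add_mem' hf hg := ⟨hf.1.add hg.1, hf.2.add hg.2⟩
  smul_mem' c _ hf := ⟨hf.1.comp (fun x => c • x), hf.2.comp_left (g := fun x => c • x)
    (smul_zero c)⟩

variable (R G) in
/-- The underlying set of the Steinberg algebra `A_R(G)`: all locally constant functions
`G → R` with compact support, with pointwise addition and scalar multiplication. Its product,
for an ample Hausdorff groupoid `G`, is the convolution, see below. -/
abbrev SteinbergAlgebra : Type _ := steinbergSubmodule R G

theorem indicator_mem [T2Space G] {f : G → R} (hf : f ∈ steinbergSubmodule R G) {U : Set G}
    (hU : IsClopen U) : U.indicator f ∈ steinbergSubmodule R G := by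
  refine ⟨?_, hf.2.of_isClosed_subset (isClosed_tsupport _) (closure_mono ?_)⟩
  · rw [IsLocallyConstant.iff_eventually_eq]
    intro x
    have h1 := (IsLocallyConstant.iff_eventually_eq f).1 hf.1 x
    by_cases hx : x ∈ U
    · filter_upwards [h1, hU.isOpen.mem_nhds hx] with y hy hyU
      simp [hx, hyU, hy]
    · filter_upwards [hU.compl.isOpen.mem_nhds hx] with y hyU
      have hy : y ∉ U := hyU
      simp [hx, hy]
  · rw [Set.support_indicator]
    exact Set.inter_subset_right

variable [Groupoid G]

theorem IsOpenBisection.injOn_rng {B : Set G} (hB : IsOpenBisection B) : Set.InjOn rng B := by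
  intro a ha b hb h
  have := hB.range_homeo.injective (a₁ := ⟨a, ha⟩) (a₂ := ⟨b, hb⟩) (Subtype.ext h)
  exact congrArg Subtype.val this

section Continuity

variable [IsTopologicalGroupoid G]

theorem continuous_rng : Continuous (rng : G → G) := by
  have h : Continuous fun a : G => (a, a⁻¹) :=
    continuous_id.prodMk IsTopologicalGroupoid.continuous_inv'
  exact IsTopologicalGroupoid.continuousOn_mul.comp_continuous h comp_self_inv

theorem continuous_src : Continuous (src : G → G) := by
  have h : Continuous fun a : G => (a⁻¹, a) :=
    IsTopologicalGroupoid.continuous_inv'.prodMk continuous_id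
  exact IsTopologicalGroupoid.continuousOn_mul.comp_continuous h comp_inv_self

theorem continuous_rangeMap : Continuous (rangeMap : G → unitSpace G) :=
  continuous_rng.subtype_mk _

variable [T2Space G]

/-- The support of `f * g` is contained in a compact set, the product of the two supports. -/
theorem hasCompactSupport_conv {f g : G → R} (hf : HasCompactSupport f)
    (hg : HasCompactSupport g) : HasCompactSupport (conv f g) := by
  have hcl : IsClosed {p : G × G | Comp p.1 p.2} := by
    simp only [comp_iff]
    exact isClosed_eq (continuous_src.comp continuous_fst) (continuous_rng.comp continuous_snd)
  have hK : IsCompact ((tsupport f ×ˢ tsupport g) ∩ {p : G × G | Comp p.1 p.2}) :=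
    (hf.prod hg).inter_right hcl
  refine HasCompactSupport.of_support_subset_isCompact
    (hK.image_of_continuousOn (IsTopologicalGroupoid.continuousOn_mul.mono
      Set.inter_subset_right)) ?_
  intro α hα
  by_contra hne
  refine hα (?_ : conv f g α = 0)
  unfold conv
  rw [← finsum_zero (α := G)]
  congr 1
  ext β
  by_cases h1 : rng β = rng α
  · have hc : Comp β⁻¹ α := by rw [comp_iff, src_inv, h1]
    have hc' : Comp β (β⁻¹ * α) := comp_mul_right _ _ _ (comp_self_inv β) hc
    have hm : β * (β⁻¹ * α) = α := by
      have := inv_mul_cancel' β⁻¹ α hc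
      rwa [inv_inv'] at this
    have : f β * g (β⁻¹ * α) = 0 := by
      by_contra h2
      exact hne ⟨(β, β⁻¹ * α), ⟨⟨subset_tsupport f (left_ne_zero_of_mul h2),
        subset_tsupport g (right_ne_zero_of_mul h2)⟩, hc'⟩, hm⟩
    simp [this]
  · simp [h1]

theorem isLocallyConstant_conv_of_bisection {f g : G → R} (hf : IsLocallyConstant f)
    (hg : IsLocallyConstant g) {B : Set G} (hBc : IsCompact B) (hB : IsOpenBisection B)
    (hs : Function.support f ⊆ B) : IsLocallyConstant (conv f g) := by
  rw [IsLocallyConstant.iff_eventually_eq]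
  intro α
  by_cases hα : ∃ β ∈ B, rng β = rng α
  · obtain ⟨β, hβ, hr⟩ := hα
    have hc : Comp β⁻¹ α := by rw [comp_iff, src_inv, hr]
    have hdiv : ContinuousOn (fun p : G × G => p.1⁻¹ * p.2) {p | Comp p.1⁻¹ p.2} := by
      have h : Continuous fun p : G × G => (p.1⁻¹, p.2) :=
        (IsTopologicalGroupoid.continuous_inv'.comp continuous_fst).prodMk continuous_snd
      exact IsTopologicalGroupoid.continuousOn_mul.comp h.continuousOn fun p hp => hp
    have h1 : ∀ᶠ p : G × G in 𝓝 (β, α), Comp p.1⁻¹ p.2 → g (p.1⁻¹ * p.2) = g (β⁻¹ * α) := by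
      have := (hdiv (β, α) hc).eventually
        ((IsLocallyConstant.iff_eventually_eq g).1 hg (β⁻¹ * α))
      exact eventually_nhdsWithin_iff.1 this
    obtain ⟨W, hW, V, hV, hWV⟩ := Filter.eventually_prod_iff.1 (nhds_prod_eq (x := β) (y := α) ▸ h1)
    have hW' : ∀ᶠ γ in 𝓝 β, W γ ∧ f γ = f β ∧ γ ∈ B :=
      hW.and (((IsLocallyConstant.iff_eventually_eq f).1 hf β).and (hB.isOpen.mem_nhds hβ))
    obtain ⟨O, hO, hOo, hβO⟩ := eventually_nhds_iff.1 hW'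
    have himg : IsOpen (B.domRestrict (rangeMap : G → unitSpace G) '' (Subtype.val ⁻¹' O)) :=
      hB.range_homeo.isOpenMap _ (hOo.preimage continuous_subtype_val)
    have hpre := (himg.preimage continuous_rangeMap).mem_nhds
      (show α ∈ _ from ⟨⟨β, hβ⟩, hβO, Subtype.ext hr⟩)
    filter_upwards [hV, hpre] with α' hα' hmem
    obtain ⟨⟨γ, hγB⟩, hγO, hγ⟩ := hmem
    have hγr : rng γ = rng α' := congrArg Subtype.val hγ
    rw [conv_eq_of_mem hB.injOn_rng hs g hβ hr, conv_eq_of_mem hB.injOn_rng hs g hγB hγr,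
      (hO γ hγO).2.1]
    rw [hWV (hO γ hγO).1 hα' (by rw [comp_iff, src_inv, hγr])]
  · have hK : IsClosed (rng '' B) := (hBc.image continuous_rng).isClosed
    have hpre := (hK.isOpen_compl.preimage continuous_rng).mem_nhds
      (show α ∈ _ from fun ⟨β, hβ, h⟩ => hα ⟨β, hβ, h⟩)
    have hz : ∀ α' : G, rng α' ∉ rng '' B → conv f g α' = 0 := by
      intro α' h
      refine conv_eq_zero g fun β hβ => ?_
      by_contra hne
      exact h ⟨β, hs hne, hβ⟩
    filter_upwards [hpre] with α' hα'
    rw [hz α' hα', hz α fun ⟨β, hβ, h⟩ => hα ⟨β, hβ, h⟩]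

end Continuity

variable [T2Space G] [IsAmple G]

/-- Every element of the Steinberg algebra is a finite sum of elements each of which is
supported in a compact open bisection. -/
theorem bisection_induction {p : (G → R) → Prop} (zero : p 0)
    (add : ∀ f ∈ steinbergSubmodule R G, ∀ g ∈ steinbergSubmodule R G, p f → p g → p (f + g))
    (bis : ∀ f ∈ steinbergSubmodule R G, ∀ B : Set G, IsCompact B → IsOpenBisection B →
      Function.support f ⊆ B → p f)
    {f : G → R} (hf : f ∈ steinbergSubmodule R G) : p f := by
  have main : ∀ t : Finset (Set G), (∀ B ∈ t, IsCompact B ∧ IsOpenBisection B) →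
      ∀ f ∈ steinbergSubmodule R G, Function.support f ⊆ ⋃ B ∈ t, B → p f := by
    classical
    intro t
    induction t using Finset.induction_on with
    | empty =>
      intro _ f _ hs
      have : f = 0 := by
        rw [← Function.support_eq_empty_iff]
        simpa using hs
      rw [this]
      exact zero
    | insert U t _ ih =>
      intro ht f hf hs
      have hU := ht U (Finset.mem_insert_self _ _)
      have hc : IsClopen U := ⟨hU.1.isClosed, hU.2.isOpen⟩
      rw [← Set.indicator_self_add_compl U f]
      refine add _ (indicator_mem hf hc) _ (indicator_mem hf hc.compl)
        (bis _ (indicator_mem hf hc) U hU.1 hU.2 Set.support_indicator_subset)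
        (ih (fun B hB => ht B (Finset.mem_insert_of_mem hB)) _ (indicator_mem hf hc.compl) ?_)
      intro x hx
      rw [Set.support_indicator] at hx
      have := hs hx.2
      simp only [Finset.mem_insert, Set.iUnion_iUnion_eq_or_left, Set.mem_union] at this
      exact this.resolve_left hx.1
  have hb : ∀ x : G, ∃ B : Set G, (IsCompact B ∧ IsOpenBisection B) ∧ x ∈ B := by
    intro x
    obtain ⟨B, hB, hx, _⟩ := (IsAmple.isTopologicalBasis (G := G)).exists_subset_of_mem_open
      (Set.mem_univ x) isOpen_univ
    exact ⟨B, hB, hx⟩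
  choose B hB hxB using hb
  obtain ⟨t, ht⟩ := hf.2.elim_finite_subcover B (fun x => (hB x).2.isOpen)
    (fun x _ => Set.mem_iUnion.2 ⟨x, hxB x⟩)
  classical
  refine main (t.image B) ?_ f hf ?_
  · intro C hC
    obtain ⟨x, _, rfl⟩ := Finset.mem_image.1 hC
    exact hB x
  · simpa using (subset_tsupport f).trans ht

theorem finite_fibre {f : G → R} (hf : f ∈ steinbergSubmodule R G) : FiniteFibres f := by
  refine bisection_induction (p := FiniteFibres) ?_ ?_ ?_ hf
  · intro α
    simp
  · intro f _ g _ h1 h2 α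
    refine ((h1 α).union (h2 α)).subset ?_
    rintro β ⟨hr, hne⟩
    by_cases h : f β = 0
    · right
      exact ⟨hr, fun h' => hne (by simp [h, h'])⟩
    · left
      exact ⟨hr, h⟩
  · intro f _ B _ hB hs α
    refine Set.Subsingleton.finite ?_
    rintro β ⟨h1, h2⟩ γ ⟨h3, h4⟩
    exact hB.injOn_rng (hs h2) (hs h4) (h1.trans h3.symm)

variable [IsTopologicalGroupoid G]

theorem conv_mem {f g : G → R} (hf : f ∈ steinbergSubmodule R G)
    (hg : g ∈ steinbergSubmodule R G) : conv f g ∈ steinbergSubmodule R G := by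
  refine bisection_induction (p := fun f => conv f g ∈ steinbergSubmodule R G) ?_ ?_ ?_ hf
  · rw [zero_conv]
    exact zero_mem _
  · intro f hf f' hf' h h'
    rw [add_conv (finite_fibre hf) (finite_fibre hf')]
    exact add_mem h h'
  · intro f hf B hBc hB hs
    exact ⟨isLocallyConstant_conv_of_bisection hf.1 hg.1 hBc hB hs,
      hasCompactSupport_conv hf.2 hg.2⟩

theorem conv_assoc {f g : G → R} (hf : f ∈ steinbergSubmodule R G)
    (hg : g ∈ steinbergSubmodule R G) (h : G → R) :
    conv (conv f g) h = conv f (conv g h) := by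
  refine bisection_induction (p := fun f => conv (conv f g) h = conv f (conv g h)) ?_ ?_ ?_ hf
  · rw [zero_conv, zero_conv, zero_conv]
  · intro f hf f' hf' e e'
    rw [add_conv (finite_fibre hf) (finite_fibre hf'), add_conv (finite_fibre (conv_mem hf hg))
      (finite_fibre (conv_mem hf' hg)), add_conv (finite_fibre hf) (finite_fibre hf'), e, e']
  · intro f _ B _ hB hs
    exact conv_assoc_of_injOn hB.injOn_rng hs (finite_fibre hg) h

noncomputable instance : Mul (SteinbergAlgebra R G) :=
  ⟨fun f g => ⟨conv f.1 g.1, conv_mem f.2 g.2⟩⟩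

theorem coe_mul (f g : SteinbergAlgebra R G) :
    ((f * g : SteinbergAlgebra R G) : G → R) = conv (f : G → R) g := rfl

/-- The Steinberg algebra is a (not necessarily unital) ring under convolution. -/
noncomputable instance : NonUnitalRing (SteinbergAlgebra R G) :=
  { (inferInstance : AddCommGroup (SteinbergAlgebra R G)),
    (inferInstance : Mul (SteinbergAlgebra R G)) with
    left_distrib := fun f g h => Subtype.ext (conv_add (finite_fibre f.2) g.1 h.1)
    right_distrib := fun f g h => Subtype.ext
      (add_conv (finite_fibre f.2) (finite_fibre g.2) h.1)
    zero_mul := fun f => Subtype.ext (zero_conv f.1)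
    mul_zero := fun f => Subtype.ext (conv_zero f.1)
    mul_assoc := fun f g h => Subtype.ext (conv_assoc f.2 g.2 h.1) }

instance : IsScalarTower R (SteinbergAlgebra R G) (SteinbergAlgebra R G) :=
  ⟨fun c f g => Subtype.ext (smul_conv (finite_fibre f.2) c g.1)⟩

instance : SMulCommClass R (SteinbergAlgebra R G) (SteinbergAlgebra R G) :=
  ⟨fun c f g => Subtype.ext (conv_smul (finite_fibre f.2) c g.1).symm⟩

end SteinbergAlgebra

end Steinberg

/-! Sufficiency. Let `I` be a nonzero ideal. Translating an `f` in `I` by the inverse of a bisection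
makes it nonzero at some unit (`exists_ne_zero_on_units`). Effectiveness gives a nonempty open set
of units on which `f` is a nonzero constant and between whose points `f` sees no nontrivial arrow;
cutting `f` down on both sides and dividing by the constant puts some 1_W in `I`
(`IsEffective.exists_charFn_mem`). The units covered by such sets W form an open invariant set,
because 1_W can be conjugated by bisections (`rng_mem_idealUnits`). By minimality they are all the
units, and by compactness every function is absorbed by some 1_W in `I`.

Necessity. Each failing condition yields a proper nonzero ideal: functions with values in a
principal ideal of `R` (`valueIdeal`), functions supported over an invariant open set of units
(`supportIdeal`), or the kernel of the action on functions on the units (`augmentationIdeal`). The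
last contains 1_B - 1_{r(B)} for every compact open bisection B of nontrivial isotropy, but not 1_B.
-/

namespace Steinberg

open Groupoid

/-! ### Identities in a groupoid -/

section Algebraic

variable {G : Type*} [Groupoid G]

theorem comp_inv_mul {a b : G} (h : rng a = rng b) : Comp a⁻¹ b := by
  rw [comp_iff, src_inv, h]

theorem mul_inv_mul {a b : G} (h : rng a = rng b) : a * (a⁻¹ * b) = b := by
  have := inv_mul_cancel' a⁻¹ b (comp_inv_mul h)
  rwa [inv_inv'] at this

theorem rng_inv_mul {a b : G} (h : rng a = rng b) : rng (a⁻¹ * b) = src a := by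
  rw [rng_mul (comp_inv_mul h), rng_inv]

theorem src_src (a : G) : src (src a) = src a := src_mul (comp_inv_self a)

theorem rng_src (a : G) : rng (src a) = src a := by
  have h : rng (a⁻¹ * a) = rng a⁻¹ := rng_mul (comp_inv_self a)
  rwa [rng_inv] at h

theorem src_of_mem {x : G} (hx : x ∈ unitSpace G) : src x = x := by
  obtain ⟨a, rfl⟩ := hx
  exact src_src a

theorem rng_of_mem {x : G} (hx : x ∈ unitSpace G) : rng x = x := by
  obtain ⟨a, rfl⟩ := hx
  exact rng_src a

theorem mul_src (a : G) : a * src a = a := mul_inv_mul rfl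

theorem src_rng (a : G) : src (rng a) = rng a := src_of_mem (rng_mem_unitSpace a)

theorem rng_rng (a : G) : rng (rng a) = rng a := rng_of_mem (rng_mem_unitSpace a)

theorem eq_of_inv_mul_mem {a b : G} (h : rng a = rng b) (hu : a⁻¹ * b ∈ unitSpace G) :
    a = b := by
  have h1 : a⁻¹ * b = src a := by rw [← rng_of_mem hu, rng_inv_mul h]
  rw [← mul_inv_mul h, h1, mul_src]

theorem injOn_rng_unitSpace {W : Set G} (hW : W ⊆ unitSpace G) : Set.InjOn rng W := by
  intro a ha b hb h
  rwa [rng_of_mem (hW ha), rng_of_mem (hW hb)] at h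

theorem unitSpace_eq_setOf : unitSpace G = {x | src x = x} := by
  ext x
  exact ⟨src_of_mem, fun h => ⟨x, h⟩⟩

end Algebraic

/-! ### Convolution with functions on the units -/

section Convolution

variable {G : Type*} [Groupoid G] {R : Type*} [CommRing R]

-- Only `β = α` contributes to the sum: if `β⁻¹ * α` is a unit then `β = α`.
open Classical in
theorem conv_indicator_unit (g : G → R) {W : Set G} (hW : W ⊆ unitSpace G) (α : G) :
    conv g (W.indicator 1) α = if src α ∈ W then g α else 0 := by
  unfold conv
  rw [finsum_eq_single _ α]
  · have : α⁻¹ * α = src α := rfl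
    by_cases h : src α ∈ W <;> simp [this, h]
  · intro β hβ
    by_cases h1 : rng β = rng α
    · have : β⁻¹ * α ∉ W := fun h => hβ (eq_of_inv_mul_mem h1 (hW h))
      simp [this]
    · simp [h1]

open Classical in
theorem indicator_unit_conv (c : R) (g : G → R) {W : Set G} (hW : W ⊆ unitSpace G) (α : G) :
    conv (W.indicator fun _ => c) g α = if rng α ∈ W then c * g α else 0 := by
  split_ifs with h
  · rw [conv_eq_of_mem (injOn_rng_unitSpace hW) Set.support_indicator_subset g h (rng_rng α)]
    have h1 : rng α * ((rng α)⁻¹ * α) = α := mul_inv_mul (rng_rng α)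
    -- Idempotence of `rng α` together with `h1` gives `rng α * α = α`; cancelling `rng α` on the
    -- left then gives the claim.
    have h2 : (rng α)⁻¹ * α = α := by
      have e : rng α * rng α = rng α := by
        have := mul_src (rng α)
        rwa [src_rng] at this
      have hc : Comp (rng α) ((rng α)⁻¹ * α) :=
        comp_mul_right _ _ _ (comp_self_inv _) (comp_inv_mul (rng_rng α))
      have hc' : Comp (rng α) (rng α) := by rw [comp_iff, src_rng, rng_rng]
      have h3 := mul_assoc' _ _ _ hc' hc
      rw [e, h1] at h3
      have h4 : (rng α)⁻¹ * (rng α * α) = α :=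
        inv_mul_cancel' _ _ (by rw [comp_iff, src_rng])
      rwa [← h3] at h4
    rw [h2]
    simp [h]
  · refine conv_eq_zero g fun β hβ => Set.indicator_of_notMem (fun hb => h ?_) _
    rwa [← hβ, rng_of_mem (hW hb)]

/-- Convolving on the left preserves the functions on `G` that factor through the range map. -/
theorem conv_comp_rng (f : G → R) (k : G → R) :
    ∃ k' : G → R, conv f (k ∘ rng) = k' ∘ rng := by
  -- Since r(β⁻¹α) = s(β), the summand does not depend on `α`, and the index set depends only on
  -- r(α).
  refine ⟨fun x => ∑ᶠ (β : G) (_ : rng β = x), f β * k (src β), ?_⟩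
  ext α
  refine finsum_congr fun β => finsum_congr fun hβ => ?_
  simp only [Function.comp_apply]
  rw [rng_inv_mul hβ]

end Convolution

/-! ### Bisections, the unit space and effectiveness -/

section Topological

variable {G : Type*} [TopologicalSpace G] [Groupoid G]

theorem IsOpenBisection.injOn_src {B : Set G} (hB : IsOpenBisection B) : Set.InjOn src B := by
  intro a ha b hb h
  have := hB.source_homeo.injective (a₁ := ⟨a, ha⟩) (a₂ := ⟨b, hb⟩) (Subtype.ext h)
  exact congrArg Subtype.val this

theorem IsOpenBisection.injOn_rng_inv {B : Set G} (hB : IsOpenBisection B) :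
    Set.InjOn rng {γ : G | γ⁻¹ ∈ B} := by
  intro a ha b hb h
  have := hB.injOn_src ha hb (by rw [src_inv, src_inv, h])
  rw [← inv_inv' a, this, inv_inv']

theorem exists_bisection [IsAmple G] {U : Set G} (hU : IsOpen U) {x : G} (hx : x ∈ U) :
    ∃ B : Set G, IsCompact B ∧ IsOpenBisection B ∧ x ∈ B ∧ B ⊆ U := by
  obtain ⟨B, hB, hxB, hBU⟩ :=
    (IsAmple.isTopologicalBasis (G := G)).exists_subset_of_mem_open hx hU
  exact ⟨B, hB.1, hB.2, hxB, hBU⟩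

variable [IsTopologicalGroupoid G]

theorem isCompact_inv {B : Set G} (hB : IsCompact B) : IsCompact {γ : G | γ⁻¹ ∈ B} := by
  convert hB.image IsTopologicalGroupoid.continuous_inv'
  ext γ
  constructor
  · exact fun h => ⟨_, h, inv_inv' γ⟩
  · rintro ⟨β, hβ, rfl⟩
    rwa [Set.mem_ofPred_eq, inv_inv']

theorem isOpen_inv {B : Set G} (hB : IsOpen B) : IsOpen {γ : G | γ⁻¹ ∈ B} :=
  hB.preimage IsTopologicalGroupoid.continuous_inv'

variable [IsAmple G]

/-- For γ near a unit, γ and s(γ) lie in one bisection and have the same source, so γ = s(γ). -/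
theorem isOpen_unitSpace : IsOpen (unitSpace G) := by
  rw [isOpen_iff_mem_nhds]
  intro u hu
  obtain ⟨B, -, hB, huB, -⟩ := exists_bisection isOpen_univ (Set.mem_univ u)
  have h1 : src ⁻¹' B ∈ 𝓝 u := (hB.isOpen.preimage continuous_src).mem_nhds
    (by rwa [Set.mem_preimage, src_of_mem hu])
  filter_upwards [h1, hB.isOpen.mem_nhds huB] with γ h2 h3
  rw [← hB.injOn_src h2 h3 (src_src γ)]
  exact src_mem_unitSpace γ

theorem IsOpenBisection.isOpen_rng_image {B O : Set G} (hB : IsOpenBisection B) (hO : IsOpen O)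
    (h : O ⊆ B) : IsOpen (rng '' O) := by
  have h1 := hB.range_homeo.isOpenMap _ (hO.preimage continuous_subtype_val)
  have h2 := isOpen_unitSpace.isOpenMap_subtype_val _ h1
  convert h2
  ext x
  constructor
  · rintro ⟨γ, hγ, rfl⟩
    exact ⟨rangeMap γ, ⟨⟨γ, h hγ⟩, hγ, rfl⟩, rfl⟩
  · rintro ⟨_, ⟨γ, hγ, rfl⟩, rfl⟩
    exact ⟨γ, hγ, rfl⟩

variable [T2Space G]

theorem isClosed_unitSpace : IsClosed (unitSpace G) := by
  rw [unitSpace_eq_setOf]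
  exact isClosed_eq continuous_src continuous_id

/-- In an effective groupoid, every nonempty open set of units contains a smaller one whose
elements are not linked by a nontrivial arrow of a given bisection. -/
theorem IsEffective.exists_open (hG : IsEffective G) {B : Set G} (hB : IsOpenBisection B)
    {U : Set G} (hU : IsOpen U) (hne : U.Nonempty) :
    ∃ V ⊆ U, IsOpen V ∧ V.Nonempty ∧
      ∀ γ ∈ B, γ ∉ unitSpace G → rng γ ∈ V → src γ ∉ V := by
  set O : Set G := (B \ unitSpace G) ∩ (rng ⁻¹' U ∩ src ⁻¹' U) with hO
  have hOo : IsOpen O := (hB.isOpen.sdiff isClosed_unitSpace).inter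
    ((hU.preimage continuous_rng).inter (hU.preimage continuous_src))
  by_cases h : ∃ γ ∈ O, src γ ≠ rng γ
  · obtain ⟨γ, hγ, hsr⟩ := h
    -- Take V = r(P), where arrows of P have range in `W₁` and source in `W₂`. An arrow of `B` with
    -- range in V lies in P by injectivity of r on `B`, so its source is in `W₂`, which misses V ⊆
    -- `W₁`.
    obtain ⟨W₁, W₂, h₁, h₂, hr, hs, hd⟩ := t2_separation hsr.symm
    set P : Set G := O ∩ (rng ⁻¹' W₁ ∩ src ⁻¹' W₂) with hP
    have hPo : IsOpen P := hOo.inter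
      ((h₁.preimage continuous_rng).inter (h₂.preimage continuous_src))
    refine ⟨rng '' P, ?_, hB.isOpen_rng_image hPo fun x hx => hx.1.1.1,
      ⟨_, γ, ⟨hγ, hr, hs⟩, rfl⟩, ?_⟩
    · rintro _ ⟨β, hβ, rfl⟩
      exact hβ.1.2.1
    · rintro β hβ - ⟨δ, hδ, hδβ⟩ ⟨ε, hε, hεβ⟩
      obtain rfl := hB.injOn_rng hδ.1.1.1 hβ hδβ
      have : rng ε ∈ W₂ := by
        rw [hεβ]
        exact hδ.2.2
      exact Set.disjoint_left.1 hd hε.2.1 this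
  · push Not at h
    -- Here O is an open set of nontrivial isotropy, hence empty by effectiveness, and `U` itself
    -- serves.
    refine ⟨U, subset_rfl, hU, hne, fun γ hγ hu hr hs => ?_⟩
    have hmem : γ ∈ interior (isotropy G \ unitSpace G) :=
      mem_interior.2 ⟨O, fun x hx => ⟨h x hx, hx.1.2⟩, hOo, ⟨hγ, hu⟩, hr, hs⟩
    rw [hG] at hmem
    exact hmem

end Topological

/-! ### Ideals of the Steinberg algebra: sufficiency of the three conditions -/

section SteinbergAlgebra

variable {R : Type*} [CommRing R] {G : Type*} [TopologicalSpace G] [T2Space G]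

variable (R) in
theorem indicator_const_mem {K : Set G} (hK : IsCompact K) (hKo : IsOpen K) (c : R) :
    K.indicator (fun _ => c) ∈ steinbergSubmodule R G := by
  refine ⟨?_, HasCompactSupport.of_support_subset_isCompact hK Set.support_indicator_subset⟩
  have h : IsClopen K := ⟨hK.isClosed, hKo⟩
  rw [IsLocallyConstant.iff_eventually_eq]
  intro x
  by_cases hx : x ∈ K
  · filter_upwards [hKo.mem_nhds hx] with y hy
    simp [hx, hy]
  · filter_upwards [h.compl.isOpen.mem_nhds hx] with y hy
    have hy : y ∉ K := hy
    simp [hx, hy]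

variable (R) in
/-- The characteristic function of a compact open set. -/
noncomputable def charFn {K : Set G} (hK : IsCompact K) (hKo : IsOpen K) :
    SteinbergAlgebra R G := ⟨K.indicator 1, indicator_const_mem R hK hKo 1⟩

theorem coe_charFn {K : Set G} (hK : IsCompact K) (hKo : IsOpen K) :
    (charFn R hK hKo : G → R) = K.indicator 1 := rfl

theorem charFn_ne_zero [Nontrivial R] {K : Set G} (hK : IsCompact K) (hKo : IsOpen K)
    (hne : K.Nonempty) : charFn R hK hKo ≠ 0 := by
  obtain ⟨x, hx⟩ := hne
  intro h
  have h1 : (charFn R hK hKo : G → R) x = 0 := by rw [h]; rfl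
  simp [charFn, hx] at h1

variable [Groupoid G] [IsTopologicalGroupoid G] [IsAmple G]

/-- The conclusion survives shrinking V, and it is asked inside every `U`; so for a sum the open
sets of the two summands can be nested. This leaves functions supported in one bisection, which is
`IsEffective.exists_open`. -/
theorem IsEffective.exists_vanishing (hG : IsEffective G) {f : G → R}
    (hf : f ∈ steinbergSubmodule R G) : ∀ U : Set G, IsOpen U → U.Nonempty →
      ∃ V ⊆ U, IsOpen V ∧ V.Nonempty ∧
        ∀ γ, γ ∉ unitSpace G → rng γ ∈ V → src γ ∈ V → f γ = 0 := by
  refine bisection_induction (p := fun f => ∀ U : Set G, IsOpen U → U.Nonempty →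
      ∃ V ⊆ U, IsOpen V ∧ V.Nonempty ∧
        ∀ γ, γ ∉ unitSpace G → rng γ ∈ V → src γ ∈ V → f γ = 0) ?_ ?_ ?_ hf
  · exact fun U hU hne => ⟨U, subset_rfl, hU, hne, fun _ _ _ _ => rfl⟩
  · intro f _ g _ h1 h2 U hU hne
    obtain ⟨V, hVU, hV, hVne, hV0⟩ := h1 U hU hne
    obtain ⟨W, hWV, hW, hWne, hW0⟩ := h2 V hV hVne
    refine ⟨W, hWV.trans hVU, hW, hWne, fun γ hu hr hs => ?_⟩
    rw [Pi.add_apply, hV0 γ hu (hWV hr) (hWV hs), hW0 γ hu hr hs, add_zero]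
  · intro f _ B _ hB hsupp U hU hne
    obtain ⟨V, hVU, hV, hVne, hV0⟩ := hG.exists_open hB hU hne
    refine ⟨V, hVU, hV, hVne, fun γ hu hr hs => ?_⟩
    by_contra h
    exact hV0 γ (hsupp h) hu hr hs

/-- A nonzero ideal contains a function that does not vanish on the unit space. -/
theorem exists_ne_zero_on_units {I : TwoSidedIdeal (SteinbergAlgebra R G)} (hI : I ≠ ⊥) :
    ∃ f ∈ I, ∃ u ∈ unitSpace G, (f : G → R) u ≠ 0 := by
  obtain ⟨f, hf, hf0⟩ : ∃ f ∈ I, f ≠ 0 := by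
    by_contra! h
    refine hI (le_bot_iff.1 fun f hf => ?_)
    rw [TwoSidedIdeal.mem_bot]
    exact h f hf
  obtain ⟨γ, hγ⟩ : ∃ γ, (f : G → R) γ ≠ 0 := by
    by_contra! h
    exact hf0 (Subtype.ext (funext h))
  obtain ⟨B, hBc, hB, hγB, -⟩ := exists_bisection isOpen_univ (Set.mem_univ γ)
  -- Left multiplication by 1_{B⁻¹} moves the value of `f` at `γ` to the unit s(γ).
  refine ⟨charFn R (isCompact_inv hBc) (isOpen_inv hB.isOpen) * f, I.mul_mem_left _ _ hf,
    src γ, src_mem_unitSpace γ, ?_⟩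
  have hm : γ⁻¹ ∈ {γ : G | γ⁻¹ ∈ B} := by rwa [Set.mem_ofPred_eq, inv_inv']
  rw [coe_mul, coe_charFn, conv_eq_of_mem hB.injOn_rng_inv Set.support_indicator_subset _ hm
    (by rw [rng_inv, rng_src])]
  rw [inv_inv', mul_src]
  simpa [hm, inv_inv', hγB] using hγ

/-- A nonzero ideal over a field, for an effective groupoid, contains the characteristic function
of a nonempty set of units. -/
theorem IsEffective.exists_charFn_mem (hG : IsEffective G) (hR : IsField R)
    {I : TwoSidedIdeal (SteinbergAlgebra R G)} (hI : I ≠ ⊥) :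
    ∃ (W : Set G) (hW : IsCompact W) (hWo : IsOpen W), W.Nonempty ∧ W ⊆ unitSpace G ∧
      charFn R hW hWo ∈ I := by
  classical
  obtain ⟨f, hf, u, hu, hfu⟩ := exists_ne_zero_on_units hI
  obtain ⟨c, hc⟩ := hR.mul_inv_cancel hfu
  -- The starting open set is where `f`, restricted to units, takes the value `f u`; so `f` is
  -- constant with inverse `c` on whatever is found inside.
  obtain ⟨V, hVU, hV, ⟨v, hv⟩, hV0⟩ := hG.exists_vanishing f.2
    (unitSpace G ∩ (f : G → R) ⁻¹' {(f : G → R) u})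
    (isOpen_unitSpace.inter (f.2.1.isOpen_fiber _)) ⟨u, hu, rfl⟩
  obtain ⟨W, hW, hWb, hvW, hWV⟩ := exists_bisection hV hv
  have hWu : W ⊆ unitSpace G := fun x hx => (hVU (hWV hx)).1
  refine ⟨W, hW, hWb.isOpen, ⟨v, hvW⟩, hWu, ?_⟩
  -- The two-sided cut-down 1_W f 1_W keeps only arrows from W to W; nontrivial ones are killed by
  -- `hV0`, and on W itself `f` is the constant `f u`.
  have key : charFn R hW hWb.isOpen =
      ⟨_, indicator_const_mem R hW hWb.isOpen c⟩ * (f * charFn R hW hWb.isOpen) := by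
    ext α
    rw [coe_mul, indicator_unit_conv _ _ hWu, coe_mul]
    change W.indicator 1 α = if rng α ∈ W then c * conv (f : G → R) (W.indicator 1) α else 0
    rw [conv_indicator_unit _ hWu]
    by_cases hα : α ∈ W
    · have h1 : (f : G → R) α = (f : G → R) u := (hVU (hWV hα)).2
      simp [rng_of_mem (hWu hα), src_of_mem (hWu hα), hα, h1, mul_comm c, hc]
    · rw [Set.indicator_of_notMem hα]
      split_ifs with hr hs
      · rw [hV0 α (fun h => hα (by rwa [← rng_of_mem h])) (hWV hr) (hWV hs), mul_zero]
      · rw [mul_zero]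
      · rfl
  rw [key]
  exact I.mul_mem_left _ _ (I.mul_mem_right _ _ hf)

/-- The units which have a neighbourhood whose characteristic function lies in `I`. -/
def idealUnits (I : TwoSidedIdeal (SteinbergAlgebra R G)) : Set G :=
  {x | ∃ (W : Set G) (hW : IsCompact W) (hWo : IsOpen W), x ∈ W ∧ W ⊆ unitSpace G ∧
    charFn R hW hWo ∈ I}

theorem isOpen_idealUnits (I : TwoSidedIdeal (SteinbergAlgebra R G)) :
    IsOpen (idealUnits I) := by
  rw [isOpen_iff_mem_nhds]
  rintro x ⟨W, hW, hWo, hx, hWu, hI⟩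
  filter_upwards [hWo.mem_nhds hx] with y hy
  exact ⟨W, hW, hWo, hy, hWu, hI⟩

/-- Conjugation by a bisection: if γ ∈ B and s(B) ⊆ W, then 1_B 1_W 1_{B⁻¹} = 1_{r(B)}. -/
theorem rng_mem_idealUnits {I : TwoSidedIdeal (SteinbergAlgebra R G)} {γ : G}
    (h : src γ ∈ idealUnits I) : rng γ ∈ idealUnits I := by
  classical
  obtain ⟨W, hW, hWo, hγW, hWu, hI⟩ := h
  obtain ⟨B, hBc, hB, hγB, hBW⟩ := exists_bisection (hWo.preimage continuous_src) hγW
  refine ⟨rng '' B, hBc.image continuous_rng, hB.isOpen_rng_image hB.isOpen subset_rfl,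
    ⟨γ, hγB, rfl⟩, ?_, ?_⟩
  · rintro _ ⟨β, -, rfl⟩
    exact rng_mem_unitSpace β
  · have h1 : charFn R hBc hB.isOpen * charFn R hW hWo = charFn R hBc hB.isOpen := by
      ext α
      refine (conv_indicator_unit _ hWu α).trans ?_
      by_cases hα : α ∈ B
      · rw [if_pos (show src α ∈ W from hBW hα)]
      · simp [charFn, hα]
    have h2 : charFn R hBc hB.isOpen * charFn R (isCompact_inv hBc) (isOpen_inv hB.isOpen) =
        charFn R (hBc.image continuous_rng) (hB.isOpen_rng_image hB.isOpen subset_rfl) := by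
      ext α
      rw [coe_mul, coe_charFn, coe_charFn, coe_charFn]
      by_cases hα : ∃ β ∈ B, rng β = rng α
      · obtain ⟨β, hβ, hr⟩ := hα
        rw [conv_eq_of_mem hB.injOn_rng Set.support_indicator_subset _ hβ hr]
        have hiff : β⁻¹ * α ∈ {γ : G | γ⁻¹ ∈ B} ↔ α ∈ rng '' B := by
          constructor
          · intro h
            -- Both sides lie in `B` and have source s(β). Then α = β(β⁻¹α) = ββ⁻¹ is the unit r(β).
            have h3 : (β⁻¹ * α)⁻¹ = β := hB.injOn_src h hβ (by rw [src_inv, rng_inv_mul hr])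
            have h4 : β⁻¹ * α = β⁻¹ := by rw [← inv_inv' (β⁻¹ * α), h3]
            refine ⟨β, hβ, ?_⟩
            conv_rhs => rw [← mul_inv_mul hr, h4]
            rfl
          · rintro ⟨δ, hδ, rfl⟩
            rw [rng_rng] at hr
            obtain rfl := hB.injOn_rng hβ hδ hr
            have : β⁻¹ * rng β = β⁻¹ := by rw [← src_inv, mul_src]
            rw [this, Set.mem_ofPred_eq, inv_inv']
            exact hβ
        simp only [Set.indicator_apply, hiff]
        simp [hβ]
      · rw [conv_eq_zero]
        · refine (Set.indicator_of_notMem ?_ _).symm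
          rintro ⟨β, hβ, rfl⟩
          exact hα ⟨β, hβ, (rng_rng β).symm⟩
        · exact fun β hβ => Set.indicator_of_notMem (fun h => hα ⟨β, h, hβ⟩) _
    rw [← h2, ← h1]
    exact I.mul_mem_right _ _ (I.mul_mem_left _ _ hI)

/-- Inclusion–exclusion: on units, convolution is the pointwise product, so 1_V 1_W = 1_{V ∩ W}. -/
theorem charFn_union_mem {I : TwoSidedIdeal (SteinbergAlgebra R G)} {V W : Set G}
    {hV : IsCompact V} {hVo : IsOpen V} {hW : IsCompact W} {hWo : IsOpen W}
    (hVu : V ⊆ unitSpace G) (hWu : W ⊆ unitSpace G) (h1 : charFn R hV hVo ∈ I)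
    (h2 : charFn R hW hWo ∈ I) : charFn R (hV.union hW) (hVo.union hWo) ∈ I := by
  classical
  have : charFn R (hV.union hW) (hVo.union hWo) =
      charFn R hV hVo + charFn R hW hWo - charFn R hV hVo * charFn R hW hWo := by
    ext α
    have h3 := conv_indicator_unit (V.indicator (1 : G → R)) hWu α
    have h4 : src α ∈ W ∧ α ∈ V ↔ α ∈ W ∧ α ∈ V :=
      and_congr_left fun h => by rw [src_of_mem (hVu h)]
    change (V ∪ W).indicator 1 α = V.indicator 1 α + W.indicator 1 α -
      conv (V.indicator (1 : G → R)) (W.indicator 1) α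
    rw [h3]
    by_cases hαV : α ∈ V
    · rw [src_of_mem (hVu hαV)]
      by_cases hαW : α ∈ W <;> simp [hαV, hαW]
    · simp [hαV, Set.indicator_apply]
  rw [this]
  exact I.sub_mem (I.add_mem h1 h2) (I.mul_mem_left _ _ h2)

theorem exists_charFn_mem_of_isCompact {I : TwoSidedIdeal (SteinbergAlgebra R G)}
    (hI : unitSpace G ⊆ idealUnits I) {K : Set G} (hK : IsCompact K) (hKu : K ⊆ unitSpace G) :
    ∃ (W : Set G) (hW : IsCompact W) (hWo : IsOpen W), K ⊆ W ∧ W ⊆ unitSpace G ∧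
      charFn R hW hWo ∈ I := by
  refine hK.induction_on (p := fun K => ∃ (W : Set G) (hW : IsCompact W) (hWo : IsOpen W),
    K ⊆ W ∧ W ⊆ unitSpace G ∧ charFn R hW hWo ∈ I) ?_ ?_ ?_ ?_
  · refine ⟨∅, isCompact_empty, isOpen_empty, subset_rfl, Set.empty_subset _, ?_⟩
    have : charFn R isCompact_empty isOpen_empty = (0 : SteinbergAlgebra R G) :=
      Subtype.ext (Set.indicator_empty _)
    rw [this]
    exact I.zero_mem
  · rintro s t hst ⟨W, hW, hWo, h, h'⟩
    exact ⟨W, hW, hWo, hst.trans h, h'⟩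
  · rintro s t ⟨V, hV, hVo, hs, hVu, hVI⟩ ⟨W, hW, hWo, ht, hWu, hWI⟩
    exact ⟨V ∪ W, hV.union hW, hVo.union hWo, Set.union_subset_union hs ht,
      Set.union_subset hVu hWu, charFn_union_mem hVu hWu hVI hWI⟩
  · intro x hx
    obtain ⟨W, hW, hWo, hxW, h⟩ := hI (hKu hx)
    exact ⟨W, mem_nhdsWithin_of_mem_nhds (hWo.mem_nhds hxW), W, hW, hWo, subset_rfl, h⟩

/-- The algebra need not have an identity, but 1_W is a right identity for `f` as soon as W contains
the sources of the support of `f`, a compact set. -/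
theorem eq_top_of_unitSpace_subset {I : TwoSidedIdeal (SteinbergAlgebra R G)}
    (hI : unitSpace G ⊆ idealUnits I) : I = ⊤ := by
  classical
  refine top_le_iff.1 fun f _ => ?_
  obtain ⟨W, hW, hWo, hKW, hWu, hWI⟩ := exists_charFn_mem_of_isCompact hI
    (f.2.2.isCompact.image continuous_src) (by rintro _ ⟨γ, -, rfl⟩; exact src_mem_unitSpace γ)
  have : f = f * charFn R hW hWo := by
    ext α
    refine Eq.symm ((conv_indicator_unit _ hWu α).trans ?_)
    split_ifs with h
    · rfl
    · by_contra hne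
      exact h (hKW ⟨α, subset_tsupport _ (Ne.symm hne), rfl⟩)
  rw [this]
  exact I.mul_mem_left _ _ hWI

theorem eq_top_of_ne_bot (hG : IsEffective G) (hmin : IsMinimal G) (hR : IsField R)
    {I : TwoSidedIdeal (SteinbergAlgebra R G)} (hI : I ≠ ⊥) : I = ⊤ := by
  obtain ⟨W, hW, hWo, ⟨w, hw⟩, hWu, hWI⟩ := hG.exists_charFn_mem hR hI
  refine eq_top_of_unitSpace_subset fun x hx => ?_
  have hinv : IsInvariant ((Subtype.val : unitSpace G → G) ⁻¹' idealUnits I) := by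
    refine Set.Subset.antisymm ?_ ?_
    -- Invariance has one substantial inclusion, this one; for the other, a unit is an arrow from
    -- itself to itself.
    · rintro _ ⟨γ, hγ, rfl⟩
      exact rng_mem_idealUnits hγ
    · rintro ⟨y, hy⟩ hyI
      refine ⟨y, ?_, Subtype.ext (rng_of_mem hy)⟩
      change src y ∈ idealUnits I
      rwa [src_of_mem hy]
  obtain h | h := hmin _ ((isOpen_idealUnits I).preimage continuous_subtype_val) hinv
  · have : (⟨w, hWu hw⟩ : unitSpace G) ∈ (Subtype.val : unitSpace G → G) ⁻¹' idealUnits I :=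
      ⟨W, hW, hWo, hw, hWu, hWI⟩
    rw [h] at this
    exact this.elim
  · exact (Set.eq_univ_iff_forall.1 h) ⟨x, hx⟩

/-! ### Three ideals, and necessity of the three conditions -/

section Necessity

/-- The functions with values in an ideal of the coefficient ring. -/
noncomputable def valueIdeal (J : Ideal R) : TwoSidedIdeal (SteinbergAlgebra R G) :=
  TwoSidedIdeal.mk' {f | ∀ α, (f : G → R) α ∈ J} (fun _ => J.zero_mem)
    (fun hf hg α => J.add_mem (hf α) (hg α)) (fun hf α => J.neg_mem (hf α))
    (fun hg _ => finsum_mem_induction (· ∈ J) J.zero_mem (fun _ _ => J.add_mem)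
      fun _ _ => J.mul_mem_left _ (hg _))
    (fun hf _ => finsum_mem_induction (· ∈ J) J.zero_mem (fun _ _ => J.add_mem)
      fun _ _ => J.mul_mem_right _ (hf _))

theorem mem_valueIdeal {J : Ideal R} {f : SteinbergAlgebra R G} :
    f ∈ valueIdeal J ↔ ∀ α, (f : G → R) α ∈ J := TwoSidedIdeal.mem_mk' ..

/-- The functions supported on the reduction to an invariant set of units. -/
noncomputable def supportIdeal (U : Set (unitSpace G)) (hU : IsInvariant U) :
    TwoSidedIdeal (SteinbergAlgebra R G) :=
  TwoSidedIdeal.mk' {f | ∀ α, rangeMap α ∉ U → (f : G → R) α = 0} (fun _ _ => rfl)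
    (fun {f g} hf hg α hα => by
      change (f : G → R) α + (g : G → R) α = 0
      rw [hf α hα, hg α hα, add_zero])
    (fun {f} hf α hα => by
      change -(f : G → R) α = 0
      rw [hf α hα, neg_zero])
    (fun {f g} hg α hα => by
      refine finsum_mem_eq_zero_of_forall_eq_zero fun β (hβ : rng β = rng α) => ?_
      rw [hg, mul_zero]
      intro h
      -- Invariance carries membership in U from r(β⁻¹α) = s(β) to r(β) = r(α).
      have h1 : rangeMap β ∈ rangeMap '' (sourceMap ⁻¹' U) :=
        ⟨β, by
          have : sourceMap β = rangeMap (β⁻¹ * α) := Subtype.ext (rng_inv_mul hβ).symm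
          rwa [Set.mem_preimage, this], rfl⟩
      rw [hU] at h1
      have : rangeMap β = rangeMap α := Subtype.ext hβ
      exact hα (this ▸ h1))
    (fun {f g} hf α hα => conv_eq_zero _ fun β hβ => hf β (by
      have : rangeMap β = rangeMap α := Subtype.ext hβ
      rwa [this]))

theorem mem_supportIdeal {U : Set (unitSpace G)} {hU : IsInvariant U}
    {f : SteinbergAlgebra R G} :
    f ∈ supportIdeal U hU ↔ ∀ α, rangeMap α ∉ U → (f : G → R) α = 0 :=
  TwoSidedIdeal.mem_mk' ..

variable (R G) in
/-- The kernel of the representation of the Steinberg algebra on functions on the unit space. -/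
noncomputable def augmentationIdeal : TwoSidedIdeal (SteinbergAlgebra R G) :=
  -- A function on the units is encoded as `k ∘ rng`; values of `k` off the units are irrelevant,
  -- and `k` need not be locally constant.
  TwoSidedIdeal.mk' {f | ∀ k : G → R, conv (f : G → R) (k ∘ rng) = 0}
    (fun _ => zero_conv _)
    (fun {f g} hf hg k => by
      refine (add_conv (finite_fibre f.2) (finite_fibre g.2) _).trans ?_
      rw [hf, hg, add_zero])
    (fun {f} hf k => by
      have h := smul_conv (finite_fibre f.2) (-1 : R) (k ∘ rng)
      rw [hf, smul_zero, neg_one_smul] at h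
      exact h)
    (fun {f g} hg k => by
      refine (conv_assoc f.2 g.2 _).trans ?_
      rw [hg, conv_zero])
    (fun {f g} hf k => by
      refine (conv_assoc f.2 g.2 _).trans ?_
      -- The action of `g` stays within functions of the form `k' ∘ rng`, which `f` annihilates.
      obtain ⟨k', hk'⟩ := conv_comp_rng (g : G → R) k
      rw [hk', hf])

theorem mem_augmentationIdeal {f : SteinbergAlgebra R G} :
    f ∈ augmentationIdeal R G ↔ ∀ k : G → R, conv (f : G → R) (k ∘ rng) = 0 :=
  TwoSidedIdeal.mem_mk' ..

theorem mem_of_mem_ne_zero [IsSimpleRing (SteinbergAlgebra R G)]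
    {I : TwoSidedIdeal (SteinbergAlgebra R G)} {f : SteinbergAlgebra R G} (hf : f ∈ I)
    (hf0 : f ≠ 0) (g : SteinbergAlgebra R G) : g ∈ I := by
  obtain h | h := eq_bot_or_eq_top I
  · rw [h, TwoSidedIdeal.mem_bot] at hf
    exact (hf0 hf).elim
  · rw [h]
    trivial

variable (R G) in
theorem nontrivial_of_isSimpleRing [IsSimpleRing (SteinbergAlgebra R G)]
    : Nontrivial R := by
  by_contra h
  rw [not_nontrivial_iff_subsingleton] at h
  have : Subsingleton (SteinbergAlgebra R G) := inferInstance
  obtain ⟨I, J, hIJ⟩ := exists_pair_ne (TwoSidedIdeal (SteinbergAlgebra R G))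
  refine hIJ (TwoSidedIdeal.ext fun f => ?_)
  rw [Subsingleton.elim f 0]
  exact iff_of_true I.zero_mem J.zero_mem

-- For a ≠ 0 the nonzero function a·1_B has values in the ideal (a). By simplicity 1_B does too, so
-- 1 ∈ (a).
variable (R G) in
theorem isField_of_isSimpleRing [IsSimpleRing (SteinbergAlgebra R G)] [Nonempty G] :
    IsField R := by
  have := nontrivial_of_isSimpleRing R G
  refine ⟨exists_pair_ne R, mul_comm, fun {a} ha => ?_⟩
  obtain ⟨x⟩ := ‹Nonempty G›
  obtain ⟨B, hBc, hB, hx, -⟩ := exists_bisection isOpen_univ (Set.mem_univ x)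
  have h1 : (⟨_, indicator_const_mem R hBc hB.isOpen a⟩ : SteinbergAlgebra R G) ∈
      valueIdeal (Ideal.span {a}) := by
    refine mem_valueIdeal.2 fun α => ?_
    by_cases hα : α ∈ B <;> simp [hα]
  have h2 := mem_of_mem_ne_zero h1 (fun h => ha (by
    simpa [hx] using congrFun (congrArg Subtype.val h) x)) (charFn R hBc hB.isOpen)
  have h3 : (1 : R) ∈ Ideal.span {a} := by
    simpa [charFn, hx] using mem_valueIdeal.1 h2 x
  obtain ⟨b, hb⟩ := Ideal.mem_span_singleton'.1 h3
  exact ⟨b, by rw [mul_comm, hb]⟩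

-- For invariant open U ≠ ∅, `supportIdeal` contains a nonzero 1_B with B ⊆ r⁻¹(U), hence also 1_C
-- for C around an arbitrary unit x; this forces x ∈ U.
variable (R G) in
theorem isMinimal_of_isSimpleRing [IsSimpleRing (SteinbergAlgebra R G)]
    : IsMinimal G := by
  have := nontrivial_of_isSimpleRing R G
  intro U hU hinv
  rw [or_iff_not_imp_left]
  intro hne
  obtain ⟨u, hu⟩ := Set.nonempty_iff_ne_empty.2 hne
  refine Set.eq_univ_of_forall fun x => ?_
  have hru : ∀ u : unitSpace G, rangeMap (u : G) = u := fun u => Subtype.ext (rng_of_mem u.2)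
  obtain ⟨B, hBc, hB, huB, hBU⟩ := exists_bisection (hU.preimage continuous_rangeMap)
    (show (u : G) ∈ rangeMap ⁻¹' U by rwa [Set.mem_preimage, hru])
  obtain ⟨C, hCc, hC, hxC, -⟩ := exists_bisection isOpen_univ (Set.mem_univ (x : G))
  have h1 : charFn R hBc hB.isOpen ∈ supportIdeal U hinv :=
    mem_supportIdeal.2 fun α hα => Set.indicator_of_notMem (fun h => hα (hBU h)) _
  have h2 := mem_of_mem_ne_zero h1 (charFn_ne_zero hBc hB.isOpen ⟨u, huB⟩) (charFn R hCc hC.isOpen)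
  by_contra hx
  have h3 := mem_supportIdeal.1 h2 x (by rwa [hru])
  simp [charFn, hxC] at h3

variable (R G) in
theorem isEffective_of_isSimpleRing [IsSimpleRing (SteinbergAlgebra R G)]
    : IsEffective G := by
  classical
  have := nontrivial_of_isSimpleRing R G
  by_contra hne
  obtain ⟨γ, hγ⟩ := Set.nonempty_iff_ne_empty.2 hne
  obtain ⟨B, hBc, hB, hγB, hBi⟩ := exists_bisection isOpen_interior hγ
  replace hBi := hBi.trans interior_subset
  have hCc := hBc.image continuous_rng
  have hCo := hB.isOpen_rng_image hB.isOpen subset_rfl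
  have hCu : rng '' B ⊆ unitSpace G := by
    rintro _ ⟨β, -, rfl⟩
    exact rng_mem_unitSpace β
  -- Since s = r on B, the function 1_B acts on functions on the units just as 1_{r(B)} does: by
  -- restriction to r(B).
  have hval : ∀ (k : G → R) (α : G), conv (B.indicator 1) (k ∘ rng) α =
      if rng α ∈ rng '' B then k (rng α) else 0 := by
    intro k α
    split_ifs with h
    · obtain ⟨β, hβ, hr⟩ := h
      rw [conv_eq_of_mem hB.injOn_rng Set.support_indicator_subset _ hβ hr]
      have hiso : src β = rng β := (hBi hβ).1
      simp [hβ, rng_inv_mul hr, hiso, hr]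
    · exact conv_eq_zero _ fun β hβ => Set.indicator_of_notMem (fun hb => h ⟨β, hb, hβ⟩) _
  have hmem : charFn R hBc hB.isOpen - charFn R hCc hCo ∈ augmentationIdeal R G := by
    refine mem_augmentationIdeal.2 fun k => ?_
    have h1 := add_conv (finite_fibre (charFn R hBc hB.isOpen - charFn R hCc hCo).2)
      (finite_fibre (charFn R hCc hCo).2) (k ∘ rng)
    rw [← Submodule.coe_add, sub_add_cancel] at h1
    have h2 : conv (charFn R hBc hB.isOpen : G → R) (k ∘ rng) =
        conv (charFn R hCc hCo : G → R) (k ∘ rng) := by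
      ext α
      refine (hval k α).trans (Eq.symm ((indicator_unit_conv 1 _ hCu α).trans ?_))
      simp
    rw [h2] at h1
    exact right_eq_add.1 h1
  have h0 : charFn R hBc hB.isOpen - charFn R hCc hCo ≠ 0 := by
    intro h
    have h1 := congrFun (congrArg Subtype.val (sub_eq_zero.1 h)) γ
    -- The two characteristic functions differ at γ, which lies in B but is not a unit.
    have h2 : γ ∉ rng '' B := fun h => (hBi hγB).2 (hCu h)
    simp [charFn, hγB, -Set.mem_image, h2] at h1
  -- Simplicity would put 1_B in the kernel, yet it sends the constant function 1 to a function with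
  -- value 1 at γ.
  have h1 := mem_augmentationIdeal.1 (mem_of_mem_ne_zero hmem h0 (charFn R hBc hB.isOpen)) 1
  have h2 := (hval 1 γ).symm.trans (congrFun h1 γ)
  rw [if_pos ⟨γ, hγB, rfl⟩] at h2
  exact one_ne_zero h2

end Necessity

end SteinbergAlgebra

end Steinberg

/-! ### The simplicity criterion -/

theorem corollary4p5 {G : Type*} [TopologicalSpace G] [T2Space G] [Steinberg.Groupoid G]
    [Steinberg.IsTopologicalGroupoid G] [Steinberg.IsAmple G] [Nonempty G]
    {R : Type*} [CommRing R] :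
    IsSimpleRing (Steinberg.SteinbergAlgebra R G) ↔
      (Steinberg.IsEffective G ∧ Steinberg.IsMinimal G) ∧ IsField R := by
  constructor
  · intro h
    exact ⟨⟨Steinberg.isEffective_of_isSimpleRing R G, Steinberg.isMinimal_of_isSimpleRing R G⟩,
      Steinberg.isField_of_isSimpleRing R G⟩
  · rintro ⟨⟨hG, hmin⟩, hR⟩
    have := hR.nontrivial
    obtain ⟨x⟩ := ‹Nonempty G›
    obtain ⟨B, hBc, hB, hx, -⟩ := Steinberg.exists_bisection isOpen_univ (Set.mem_univ x)
    -- `IsSimpleRing` also asks that the zero ideal and the whole algebra differ; the bisection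
    -- around `x` provides a nonzero element.
    have : Nontrivial (Steinberg.SteinbergAlgebra R G) :=
      ⟨_, _, Steinberg.charFn_ne_zero hBc hB.isOpen ⟨x, hx⟩⟩
    exact ⟨⟨fun I => or_iff_not_imp_left.2 fun hI =>
      Steinberg.eq_top_of_ne_bot hG hmin hR hI⟩⟩
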